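/- For a prime $q$ let $d=\pi(q-1)$ be the number of primes less than $q$, and let $p_1<p_2<\dots<p_d$ be these primes. For $1\le n\le q-1$ write $n=\prod_{i=1}^d p_i^{\mu_i(n)}$ and let $\mathscr L_n:\mathbb F_q^d\to\mathbb F_q$ be the linear form $\mathscr L_n(\mathbf v)=\sum_{i=1}^d \mu_i(n)v_i$. For $x_0\in\mathbb F_q^\times$ let $$N_q(x_0)=\#\{\mathbf v\in\mathbb F_q^d:\ \mathscr L_n(\mathbf v)\neq x_0\ \text{ for all } n\in\{1,2,\dots,q-1\}\},\qquad c(q)=c(q,x_0)=\frac{N_q(x_0)}{q^d}.$$ **Theorem 1.1.** As $q\to\infty$ through the primes, $$c(q)=\frac1e+O\left(\frac1{\log\log q}\right),$$ uniformly in $x_0$; that is, there are absolute constants $C$ and $q_0$ such that $\left|c(q,x_0)-\frac1e\right|\le \frac{C}{\log\log q}$ for every prime $q\ge q_0$ and every $x_0\in\mathbb F_q^\times$. -/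

import Mathlib

namespace FixedPoints

/-- The number `d = π(q - 1)` of primes `p ≤ q - 1`. -/
def dim (q : ℕ) : ℕ := Nat.primeCounting (q - 1)

/-- `prm i` is the prime number of index `i` in increasing order, counted from `0`:
`prm 0 = 2`, `prm 1 = 3`, … So `prm 0 < ⋯ < prm (dim q - 1)` are the primes `≤ q - 1`. -/
noncomputable def prm (i : ℕ) : ℕ := Nat.nth Nat.Prime i

/-- The exponent `μ_i(n)` of the prime of index `i` in the factorization of `n`. -/
noncomputable def mu (i n : ℕ) : ℕ := n.factorization (prm i)

/-- The linear form `L_n(v) = ∑ i, μ_i(n) v_i` on `F_q ^ d`, where `d = π(q - 1)`. -/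
noncomputable def linForm (q n : ℕ) : (Fin (dim q) → ZMod q) →ₗ[ZMod q] ZMod q :=
  ∑ i : Fin (dim q), (mu i n : ZMod q) • LinearMap.proj i

theorem linForm_apply (q n : ℕ) (v : Fin (dim q) → ZMod q) :
    linForm q n v = ∑ i : Fin (dim q), (mu i n : ZMod q) * v i := by
  simp [linForm]

/-- `N_q(x₀)`: the number of `v ∈ F_q ^ d` with `L_n(v) ≠ x₀` for all `1 ≤ n ≤ q - 1`. -/
noncomputable def numAvoiding (q : ℕ) (x₀ : ZMod q) : ℕ :=
  Set.ncard {v : Fin (dim q) → ZMod q | ∀ n ∈ Finset.Icc 1 (q - 1), linForm q n v ≠ x₀}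

/-- The density `c(q) = N_q(x₀) / q ^ d`. -/
noncomputable def density (q : ℕ) (x₀ : ZMod q) : ℝ :=
  (numAvoiding q x₀ : ℝ) / (q : ℝ) ^ dim q

end FixedPoints

/-! For uniform `v`, let `X` count the `n` in `[2, q - 1]` with `linForm q n v = x₀`. The claim is
that `X` is asymptotically Poisson with mean 1, so that `X = 0` has probability near `1 / e`. The
binomial moment of order `j` is the sum, over `j`-element sets `U` of indices, of the probability
that all of `U` is hit. Independent forms give exactly `q ^ (-j)`, and almost all `U` are
independent, so the moment is near `1 / j!`. Bonferroni's inequalities up to order `k` then finish.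

Independence (`linForm_notMem_span`): if the form of `n` depends on those of `U`, every prime
dividing `n` divides some `u ∈ U`. The squarefree part of `n` then divides a product of fewer than
`k` numbers `gcd(n, u)`. This is impossible if these are all at most `G` while the squarefree part
exceeds `G ^ k`. Pairs violating these conditions are "bad" and rare (`card_badPairs_le`).

Sets containing a bad pair must also contribute little, although they may be dependent. Any two
distinct indices are both hit with probability at most `q ^ (-2)` (`card_sols_pair_le`). Given this,
the power moments of `X` stay bounded by powers of `log q` (`sum_card_hits_pow_le`), because a span
of `r` forms contains at most `(log₂ q + 1) ^ r` of the forms (`card_le_of_linForm_mem_span`).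
Taking `k` about `log log q` and `G` large compared with these powers gives the theorem. -/

namespace FixedPoints

open Finset

/-! ### Solution counts and conditional moments for families of linear forms. -/

section LinearForms

variable {F V α : Type*} [Field F] [AddCommGroup V] [Module F V]

open Classical in
/-- The common solutions `v` of the equations `ℓ u v = x₀`, `u ∈ U`. -/
noncomputable def sols [Fintype V] (l : α → Module.Dual F V) (x₀ : F) (U : Finset α) : Finset V :=
  univ.filter fun v => ∀ u ∈ U, l u v = x₀

open Classical in
/-- The indices in `N` at which the value at `v` is `x₀`. -/
noncomputable def hits (l : α → Module.Dual F V) (x₀ : F) (N : Finset α) (v : V) : Finset α :=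
  N.filter fun n => l n v = x₀

theorem mem_sols [Fintype V] {l : α → Module.Dual F V} {x₀ : F} {U : Finset α} {v : V} :
    v ∈ sols l x₀ U ↔ ∀ u ∈ U, l u v = x₀ := by
  simp [sols]

theorem mem_hits {l : α → Module.Dual F V} {x₀ : F} {N : Finset α} {v : V} {n : α} :
    n ∈ hits l x₀ N v ↔ n ∈ N ∧ l n v = x₀ := by
  simp [hits]

theorem card_sols_empty [Fintype V] (l : α → Module.Dual F V) (x₀ : F) :
    #(sols l x₀ ∅) = Fintype.card V := by
  simp [sols]

-- Independence gives a `w` killed by the forms in `U` with `l n w = 1`. Translating along `w`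
-- identifies `F × sols (insert n U)` with `sols U`.
open Classical in
theorem card_sols_insert [Fintype F] [Fintype V] (l : α → Module.Dual F V) (x₀ : F) (U : Finset α) (n : α)
    (hn : l n ∉ Submodule.span F (l '' (U : Set α))) :
    Fintype.card F * #(sols l x₀ (insert n U)) = #(sols l x₀ U) := by
  obtain ⟨w, hwU, hwn⟩ : ∃ w, (∀ u ∈ U, l u w = 0) ∧ l n w = 1 := by
    have h : ¬ (⨅ i : U, LinearMap.ker (l i) ≤ LinearMap.ker (l n)) := by
      intro h
      have := mem_span_of_iInf_ker_le_ker (L := fun i : U => l i) h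
      apply hn
      convert this using 2
      ext x
      simp
    obtain ⟨w, hw, hwn⟩ := SetLike.not_le_iff_exists.mp h
    refine ⟨(l n w)⁻¹ • w, ?_, ?_⟩
    · intro u hu
      have := (Submodule.mem_iInf _).mp hw ⟨u, hu⟩
      simp only [LinearMap.mem_ker] at this
      simp [this]
    · simp only [LinearMap.mem_ker] at hwn
      simp [hwn]
  rw [← Finset.card_univ, ← Finset.card_product]
  refine Finset.card_nbij' (fun p => p.2 + p.1 • w)
    (fun v => (l n v - x₀, v - (l n v - x₀) • w)) ?_ ?_ ?_ ?_
  · rintro ⟨c, v⟩ h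
    simp only [coe_product, Set.mem_prod, SetLike.mem_coe, mem_sols] at h ⊢
    intro u hu
    simp [hwU u hu, h.2 u (mem_insert_of_mem hu)]
  · intro v h
    simp only [coe_product, Set.mem_prod, SetLike.mem_coe, mem_sols] at h ⊢
    refine ⟨mem_univ _, ?_⟩
    intro u hu
    rcases Finset.mem_insert.mp hu with rfl | hu
    · simp [hwn]
    · simp [hwU u hu, h u hu]
  · rintro ⟨c, v⟩ h
    simp only [coe_product, Set.mem_prod, SetLike.mem_coe, mem_sols] at h
    have := h.2 n (mem_insert_self _ _)
    simp [hwn, this]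
  · intro v h
    simp

/-- One more equation: at most `B` indices in `N` are dependent on `U`, and each of the others
divides the number of solutions by `|F|`. -/
theorem sum_card_sols_insert_le [Fintype F] [Fintype V] [DecidableEq α] (l : α → Module.Dual F V) (x₀ : F)
    (N U : Finset α) (B : ℕ) (hN : #N ≤ Fintype.card F)
    (hB : ∀ S ⊆ N, (∀ n ∈ S, l n ∈ Submodule.span F (l '' (U : Set α))) → #S ≤ B) :
    ∑ n ∈ N, #(sols l x₀ (insert n U)) ≤ (B + 1) * #(sols l x₀ U) := by
  classical
  rw [← Finset.sum_filter_add_sum_filter_not N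
    (fun n => l n ∈ Submodule.span F (l '' (U : Set α))), add_mul, one_mul]
  gcongr
  · calc _ ≤ ∑ n ∈ N with l n ∈ Submodule.span F (l '' (U : Set α)), #(sols l x₀ U) := by
          refine Finset.sum_le_sum fun n _ => Finset.card_le_card fun v hv => ?_
          rw [mem_sols] at hv ⊢
          exact fun u hu => hv u (mem_insert_of_mem hu)
      _ ≤ _ := by
          rw [Finset.sum_const, smul_eq_mul]
          exact Nat.mul_le_mul_right _
            (hB _ (Finset.filter_subset _ _) fun n hn => (Finset.mem_filter.mp hn).2)
  · have hF : 0 < Fintype.card F := Fintype.card_pos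
    refine Nat.le_of_mul_le_mul_left ?_ hF
    rw [Finset.mul_sum]
    calc _ = ∑ n ∈ N with l n ∉ Submodule.span F (l '' (U : Set α)), #(sols l x₀ U) := by
          refine Finset.sum_congr rfl fun n hn => ?_
          convert card_sols_insert l x₀ U n (Finset.mem_filter.mp hn).2
      _ ≤ _ := by
          rw [Finset.sum_const, smul_eq_mul]
          exact Nat.mul_le_mul_right _ ((Finset.card_filter_le _ _).trans hN)

/-- Moments of the hit count conditioned on `U` being hit. Expanding one factor of the power as a
sum over `n` moves `n` into `U`. The order drops by one while `#U` grows by at most one, so `#U + m`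
does not increase and one bound serves the whole induction. -/
theorem sum_card_hits_pow_le [Fintype F] [Fintype V] (l : α → Module.Dual F V) (x₀ : F) (N : Finset α) (L : ℕ)
    (hL : 1 ≤ L) (hN : #N ≤ Fintype.card F)
    (hspan : ∀ U S : Finset α, S ⊆ N →
      (∀ n ∈ S, l n ∈ Submodule.span F (l '' (U : Set α))) → #S ≤ L ^ #U) (m : ℕ) :
    ∀ U : Finset α, ∑ v ∈ sols l x₀ U, #(hits l x₀ N v) ^ m ≤
      (L ^ (#U + m) + 1) ^ m * #(sols l x₀ U) := by
  classical
  induction m with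
  | zero => intro U; simp
  | succ m ih =>
    intro U
    have key : ∑ v ∈ sols l x₀ U, #(hits l x₀ N v) ^ (m + 1) =
        ∑ n ∈ N, ∑ v ∈ sols l x₀ (insert n U), #(hits l x₀ N v) ^ m := by
      have h1 : ∀ v ∈ sols l x₀ U, #(hits l x₀ N v) ^ (m + 1) =
          ∑ n ∈ N, if l n v = x₀ then #(hits l x₀ N v) ^ m else 0 := by
        intro v _
        rw [← Finset.sum_filter, Finset.sum_const, smul_eq_mul, pow_succ']
        simp [hits]
      rw [Finset.sum_congr rfl h1, Finset.sum_comm]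
      refine Finset.sum_congr rfl fun n _ => ?_
      rw [← Finset.sum_filter]
      refine Finset.sum_congr ?_ fun _ _ => rfl
      ext v
      simp only [Finset.mem_filter, mem_sols, Finset.forall_mem_insert]
      tauto
    rw [key]
    calc _ ≤ ∑ n ∈ N, (L ^ (#U + (m + 1)) + 1) ^ m * #(sols l x₀ (insert n U)) := by
          refine Finset.sum_le_sum fun n _ => (ih _).trans ?_
          have : #(insert n U) + m ≤ #U + (m + 1) := by
            have := Finset.card_insert_le n U
            omega
          gcongr
      _ ≤ (L ^ (#U + (m + 1)) + 1) ^ m * ((L ^ #U + 1) * #(sols l x₀ U)) := by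
          rw [← Finset.mul_sum]
          exact Nat.mul_le_mul_left _ (sum_card_sols_insert_le l x₀ N U _ hN (hspan U))
      _ ≤ _ := by
          rw [pow_succ, mul_assoc]
          gcongr
          omega

theorem sum_choose_card_hits [Fintype V] (l : α → Module.Dual F V) (x₀ : F) (N : Finset α) (j : ℕ) :
    ∑ v : V, (#(hits l x₀ N v)).choose j = ∑ U ∈ N.powersetCard j, #(sols l x₀ U) := by
  classical
  simp only [Finset.card_eq_sum_ones (sols l x₀ _)]
  simp only [sols, Finset.sum_filter]
  rw [Finset.sum_comm]
  refine Finset.sum_congr rfl fun v _ => ?_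
  rw [← Finset.card_powersetCard, Finset.card_eq_sum_ones, ← Finset.sum_filter]
  refine Finset.sum_congr ?_ fun _ _ => rfl
  ext U
  simp only [Finset.mem_powersetCard, Finset.mem_filter, Finset.subset_iff, mem_hits]
  constructor
  · rintro ⟨h, hc⟩
    exact ⟨⟨fun x hx => (h hx).1, hc⟩, fun u hu => (h hu).2⟩
  · rintro ⟨⟨h, hc⟩, h'⟩
    exact ⟨fun x hx => ⟨h hx, h' x hx⟩, hc⟩

end LinearForms

/-! ### Bonferroni inequalities and the size of binomial coefficients. -/

section Bonferroni

/-- For `t ≥ 1` the truncated alternating sum equals `± (t - 1).choose (k - 1)`, which Pascal's rule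
bounds by `t.choose k`. -/
theorem abs_indicator_sub_alternating_sum_choose_le (t k : ℕ) (hk : 1 ≤ k) :
    |(if t = 0 then (1 : ℝ) else 0) - ∑ j ∈ range k, (-1 : ℝ) ^ j * (t.choose j : ℝ)| ≤
      (t.choose k : ℝ) := by
  obtain ⟨k, rfl⟩ : ∃ m, k = m + 1 := ⟨k - 1, by omega⟩
  rcases Nat.eq_zero_or_pos t with rfl | ht
  · have : ∑ j ∈ range (k + 1), (-1 : ℝ) ^ j * ((Nat.choose 0 j : ℕ) : ℝ) = 1 := by
      rw [Finset.sum_range_succ']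
      simp
    rw [this]
    simp
  · obtain ⟨t, rfl⟩ : ∃ m, t = m + 1 := ⟨t - 1, by omega⟩
    have h := Int.alternating_sum_range_choose_eq_choose (n := t) (m := k)
    have h' : ∑ j ∈ range (k + 1), (-1 : ℝ) ^ j * (((t + 1).choose j : ℕ) : ℝ) =
        (-1) ^ k * (t.choose k : ℝ) := by
      exact_mod_cast h
    rw [h']
    simp only [Nat.add_eq_zero_iff, one_ne_zero, and_false, if_false, zero_sub, abs_neg, abs_mul,
      abs_pow, abs_one, one_pow, one_mul, Nat.abs_cast]
    exact_mod_cast (Nat.choose_succ_succ t k) ▸ Nat.le_add_right _ _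

theorem abs_card_filter_eq_zero_sub_le {Ω : Type*} [Fintype Ω] (X : Ω → ℕ) (k : ℕ) (hk : 1 ≤ k) :
    |(#{v | X v = 0} : ℝ) - ∑ j ∈ range k, (-1 : ℝ) ^ j * ((∑ v, (X v).choose j : ℕ) : ℝ)| ≤
      ((∑ v, (X v).choose k : ℕ) : ℝ) := by
  have h1 : (#{v | X v = 0} : ℝ) = ∑ v, if X v = 0 then (1 : ℝ) else 0 := by
    simp
  have h2 : ∑ j ∈ range k, (-1 : ℝ) ^ j * ((∑ v, (X v).choose j : ℕ) : ℝ) =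
      ∑ v, ∑ j ∈ range k, (-1 : ℝ) ^ j * ((X v).choose j : ℝ) := by
    rw [Finset.sum_comm]
    push_cast
    simp only [Finset.mul_sum]
  rw [h1, h2, ← Finset.sum_sub_distrib]
  refine (Finset.abs_sum_le_sum_abs _ _).trans ?_
  push_cast
  exact Finset.sum_le_sum fun v _ => abs_indicator_sub_alternating_sum_choose_le _ _ hk

theorem abs_choose_div_pow_sub_le {n q j : ℕ} (hq : 0 < q) (hn : n ≤ q) :
    |(n.choose j : ℝ) / (q : ℝ) ^ j - 1 / (j.factorial : ℝ)| ≤ j * (j + (q - n)) / q := by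
  have hq' : (0 : ℝ) < q := by exact_mod_cast hq
  have hn' : (n : ℝ) ≤ q := by exact_mod_cast hn
  have hf : (1 : ℝ) ≤ j.factorial := by exact_mod_cast Nat.one_le_iff_ne_zero.mpr j.factorial_ne_zero
  have hD : (n.choose j : ℝ) = n.descFactorial j / j.factorial := by
    rw [Nat.descFactorial_eq_factorial_mul_choose]
    push_cast
    field_simp
  have hup : (n.descFactorial j : ℝ) ≤ (q : ℝ) ^ j := by
    calc (n.descFactorial j : ℝ) ≤ (n : ℝ) ^ j := by exact_mod_cast Nat.descFactorial_le_pow n j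
      _ ≤ _ := by gcongr
  have hlow : 1 - j * (j + (q - n)) / (q : ℝ) ≤ (n.descFactorial j : ℝ) / (q : ℝ) ^ j := by
    rcases le_or_gt j n with hj | hj
    · have hj' : (j : ℝ) ≤ n := by exact_mod_cast hj
      have h1 : ((n : ℝ) - j) ^ j ≤ n.descFactorial j := by
        have h := Nat.pow_sub_le_descFactorial n j
        have h2 : (n - j) ^ j ≤ (n + 1 - j) ^ j := by gcongr; omega
        have h3 : (((n - j : ℕ) : ℝ)) ^ j ≤ n.descFactorial j := by exact_mod_cast h2.trans h
        rwa [Nat.cast_sub hj] at h3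
      -- Bernoulli's inequality, applied to `((n - j) / q) ^ j`.
      have h2 := one_add_mul_le_pow (a := -((j + (q - n)) / q : ℝ)) (by
        rw [neg_le_neg_iff, div_le_iff₀ hq']; linarith) j
      calc 1 - j * (j + (q - n)) / (q : ℝ) = 1 + j * -((j + (q - n)) / q : ℝ) := by ring
        _ ≤ _ := h2
        _ = ((n : ℝ) - j) ^ j / (q : ℝ) ^ j := by
            rw [← div_pow]; congr 1; field_simp; ring
        _ ≤ _ := by gcongr
    · have hj' : (n : ℝ) < j := by exact_mod_cast hj
      have hj1 : (1 : ℝ) ≤ j := by exact_mod_cast (by omega : 1 ≤ j)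
      have : (1 : ℝ) ≤ j * (j + (q - n)) / q := by
        rw [le_div_iff₀ hq']; nlinarith
      have : 0 ≤ (n.descFactorial j : ℝ) / (q : ℝ) ^ j := by positivity
      linarith
  have hup' : (n.descFactorial j : ℝ) / (q : ℝ) ^ j ≤ 1 := by
    rw [div_le_one (by positivity)]; exact hup
  have : (n.choose j : ℝ) / (q : ℝ) ^ j - 1 / (j.factorial : ℝ) =
      ((n.descFactorial j : ℝ) / (q : ℝ) ^ j - 1) / j.factorial := by
    rw [hD]; field_simp
  rw [this, abs_div, abs_of_nonpos (by linarith), abs_of_pos (by linarith : (0 : ℝ) < j.factorial)]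
  calc _ ≤ -((n.descFactorial j : ℝ) / (q : ℝ) ^ j - 1) := div_le_self (by linarith) hf
    _ ≤ _ := by linarith

end Bonferroni

/-! ### Binomial moments of the hit count and the Poisson limit. -/

section Poisson

variable {F V α : Type*} [Field F] [Fintype F] [AddCommGroup V] [Module F V] [Fintype V]

/-- `U` contains two distinct elements related by `bad`. -/
def HasBadPair (bad : α → α → Prop) (U : Finset α) : Prop :=
  ∃ a ∈ U, ∃ b ∈ U, a ≠ b ∧ bad a b

theorem card_pow_mul_card_sols [DecidableEq α] (l : α → Module.Dual F V) (x₀ : F) (N : Finset α)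
    (k : ℕ) (bad : α → α → Prop)
    (hind : ∀ U ⊆ N, ∀ n ∈ N, n ∉ U → #U < k → ¬ HasBadPair bad (insert n U) →
      l n ∉ Submodule.span F (l '' (U : Set α))) (U : Finset α) :
    U ⊆ N → #U ≤ k → ¬ HasBadPair bad U →
      Fintype.card F ^ #U * #(sols l x₀ U) = Fintype.card V := by
  induction U using Finset.induction_on with
  | empty => intros; simp [card_sols_empty]
  | insert n U hnU ih =>
    intro hUN hk hbad
    rw [Finset.card_insert_of_notMem hnU] at hk ⊢
    have hUN' := (Finset.subset_insert n U).trans hUN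
    have hbad' : ¬ HasBadPair bad U := by
      rintro ⟨a, ha, b, hb, h⟩
      exact hbad ⟨a, mem_insert_of_mem ha, b, mem_insert_of_mem hb, h⟩
    rw [← ih hUN' (by omega) hbad', pow_succ, mul_assoc]
    congr 1
    convert card_sols_insert l x₀ U n
      (hind U hUN' n (hUN (mem_insert_self _ _)) hnU (by omega) hbad)

open Classical in
/-- The ordered pairs of distinct elements of `N` related by `bad`. -/
noncomputable def badPairs (bad : α → α → Prop) (N : Finset α) : Finset (α × α) :=
  N.offDiag.filter fun p => bad p.1 p.2

-- A set `U` with a bad pair, together with a solution `v`, is recorded by the pair `(a, b)`, a `v`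
-- solving both its equations, and a `j`-subset of the hits of `v`. The last has at most `#hits ^ j`
-- choices, so the conditional moment bound given `{a, b}` applies.
open Classical in
theorem card_sq_mul_sum_card_sols_le (l : α → Module.Dual F V) (x₀ : F) (N : Finset α) (L : ℕ)
    (hL : 1 ≤ L) (hN : #N ≤ Fintype.card F)
    (hspan : ∀ U S : Finset α, S ⊆ N →
      (∀ n ∈ S, l n ∈ Submodule.span F (l '' (U : Set α))) → #S ≤ L ^ #U)
    (bad : α → α → Prop)
    (hpair : ∀ a ∈ N, ∀ b ∈ N, a ≠ b →
      Fintype.card F ^ 2 * #(sols l x₀ {a, b}) ≤ Fintype.card V) (j : ℕ) :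
    Fintype.card F ^ 2 * ∑ U ∈ N.powersetCard j with HasBadPair bad U, #(sols l x₀ U) ≤
      #(badPairs bad N) * ((L ^ (2 + j) + 1) ^ j * Fintype.card V) := by
  have h1 : ∑ U ∈ N.powersetCard j with HasBadPair bad U, #(sols l x₀ U) ≤
      ∑ p ∈ badPairs bad N, ∑ v ∈ sols l x₀ {p.1, p.2}, #(hits l x₀ N v) ^ j := by
    have e1 : ∑ U ∈ N.powersetCard j with HasBadPair bad U, #(sols l x₀ U) =
        #(((N.powersetCard j).filter (HasBadPair bad)).sigma fun U => sols l x₀ U) := by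
      rw [Finset.card_sigma]
    have e2 : ∀ v, #((hits l x₀ N v).powersetCard j) ≤ #(hits l x₀ N v) ^ j := by
      intro v
      rw [Finset.card_powersetCard]
      exact Nat.choose_le_pow _ _
    have e3 : ((N.powersetCard j).filter (HasBadPair bad)).sigma (fun U => sols l x₀ U) ⊆
        (badPairs bad N).biUnion fun p => (sols l x₀ {p.1, p.2}).biUnion fun v =>
          ((hits l x₀ N v).powersetCard j).image fun U => (⟨U, v⟩ : Σ _ : Finset α, V) := by
      rintro ⟨U, v⟩ h
      rw [Finset.mem_sigma, Finset.mem_filter, Finset.mem_powersetCard] at h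
      obtain ⟨⟨⟨hUN, hU⟩, a, ha, b, hb, hab, hbad⟩, hv⟩ := h
      simp only at hUN hU ha hb hv
      rw [mem_sols] at hv
      rw [Finset.mem_biUnion]
      refine ⟨(a, b), by simp [badPairs, hUN ha, hUN hb, hab, hbad], ?_⟩
      rw [Finset.mem_biUnion]
      refine ⟨v, by simp [mem_sols, hv a ha, hv b hb], ?_⟩
      rw [Finset.mem_image]
      refine ⟨U, ?_, rfl⟩
      rw [Finset.mem_powersetCard]
      exact ⟨fun u hu => mem_hits.mpr ⟨hUN hu, hv u hu⟩, hU⟩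
    rw [e1]
    refine (Finset.card_le_card e3).trans (Finset.card_biUnion_le.trans ?_)
    refine Finset.sum_le_sum fun p _ => Finset.card_biUnion_le.trans ?_
    exact Finset.sum_le_sum fun v _ => Finset.card_image_le.trans (e2 v)
  calc _ ≤ Fintype.card F ^ 2 *
        ∑ p ∈ badPairs bad N, ∑ v ∈ sols l x₀ {p.1, p.2}, #(hits l x₀ N v) ^ j := by gcongr
    _ = ∑ p ∈ badPairs bad N,
        Fintype.card F ^ 2 * ∑ v ∈ sols l x₀ {p.1, p.2}, #(hits l x₀ N v) ^ j :=
        Finset.mul_sum _ _ _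
    _ ≤ ∑ p ∈ badPairs bad N, (L ^ (2 + j) + 1) ^ j * Fintype.card V := by
        refine Finset.sum_le_sum fun p hp => ?_
        simp only [badPairs, Finset.mem_filter, Finset.mem_offDiag] at hp
        calc _ ≤ Fintype.card F ^ 2 * ((L ^ (2 + j) + 1) ^ j * #(sols l x₀ {p.1, p.2})) := by
              gcongr
              have := sum_card_hits_pow_le l x₀ N L hL hN hspan j {p.1, p.2}
              rwa [Finset.card_pair hp.1.2.2] at this
          _ = (L ^ (2 + j) + 1) ^ j * (Fintype.card F ^ 2 * #(sols l x₀ {p.1, p.2})) := by ring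
          _ ≤ _ := by
              gcongr
              exact hpair _ hp.1.1 _ hp.1.2.1 hp.1.2.2
    _ = _ := by rw [Finset.sum_const, smul_eq_mul]

open Classical in
theorem sq_mul_card_filter_hasBadPair_le (N : Finset α) (bad : α → α → Prop) (q j : ℕ)
    (hN : #N ≤ q) :
    q ^ 2 * #{U ∈ N.powersetCard j | HasBadPair bad U} ≤ #(badPairs bad N) * q ^ j := by
  rcases lt_or_ge j 2 with hj | hj
  · have : {U ∈ N.powersetCard j | HasBadPair bad U} = ∅ := by
      refine Finset.filter_eq_empty_iff.mpr fun U hU => ?_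
      rintro ⟨a, ha, b, hb, hab, -⟩
      have := Finset.one_lt_card.mpr ⟨a, ha, b, hb, hab⟩
      rw [(Finset.mem_powersetCard.mp hU).2] at this
      omega
    simp [this]
  · have e1 : {U ∈ N.powersetCard j | HasBadPair bad U} ⊆
        (badPairs bad N).biUnion fun p =>
          (N.powersetCard (j - 2)).image fun W => W ∪ {p.1, p.2} := by
      intro U h
      rw [Finset.mem_filter, Finset.mem_powersetCard] at h
      obtain ⟨⟨hUN, hU⟩, a, ha, b, hb, hab, hbad⟩ := h
      have hs : {a, b} ⊆ U := by simp [Finset.insert_subset_iff, ha, hb]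
      rw [Finset.mem_biUnion]
      refine ⟨(a, b), by simp [badPairs, hUN ha, hUN hb, hab, hbad], ?_⟩
      rw [Finset.mem_image]
      refine ⟨U \ {a, b}, ?_, Finset.sdiff_union_of_subset hs⟩
      rw [Finset.mem_powersetCard, Finset.card_sdiff_of_subset hs, Finset.card_pair hab, hU]
      exact ⟨Finset.sdiff_subset.trans hUN, rfl⟩
    have e2 : #{U ∈ N.powersetCard j | HasBadPair bad U} ≤ #(badPairs bad N) * q ^ (j - 2) := by
      refine (Finset.card_le_card e1).trans (Finset.card_biUnion_le_card_mul _ _ _ fun p _ => ?_)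
      refine Finset.card_image_le.trans ?_
      rw [Finset.card_powersetCard]
      exact (Nat.choose_le_pow _ _).trans (Nat.pow_le_pow_left hN _)
    calc _ ≤ q ^ 2 * (#(badPairs bad N) * q ^ (j - 2)) := by gcongr
      _ = #(badPairs bad N) * (q ^ (j - 2) * q ^ 2) := by ring
      _ = _ := by rw [← pow_add]; congr 3; omega

open Classical in
theorem abs_sum_choose_card_hits_div_sub_le (l : α → Module.Dual F V) (x₀ : F) (N : Finset α)
    (L k : ℕ) (hL : 1 ≤ L) (hN : #N ≤ Fintype.card F)
    (hspan : ∀ U S : Finset α, S ⊆ N →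
      (∀ n ∈ S, l n ∈ Submodule.span F (l '' (U : Set α))) → #S ≤ L ^ #U)
    (bad : α → α → Prop)
    (hind : ∀ U ⊆ N, ∀ n ∈ N, n ∉ U → #U < k → ¬ HasBadPair bad (insert n U) →
      l n ∉ Submodule.span F (l '' (U : Set α)))
    (hpair : ∀ a ∈ N, ∀ b ∈ N, a ≠ b →
      Fintype.card F ^ 2 * #(sols l x₀ {a, b}) ≤ Fintype.card V) (j : ℕ) (hj : j ≤ k) :
    |((∑ v : V, (#(hits l x₀ N v)).choose j : ℕ) : ℝ) / Fintype.card V - 1 / (j.factorial : ℝ)| ≤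
      (#(badPairs bad N) : ℝ) / (Fintype.card F : ℝ) ^ 2 * ((L ^ (2 + k) + 1) ^ k + 1) +
        k * (k + (Fintype.card F - #N)) / (Fintype.card F : ℝ) := by
  set q := Fintype.card F with hq
  set Q := Fintype.card V with hQ
  have hq0 : 0 < q := Fintype.card_pos
  have hQ0 : 0 < Q := Fintype.card_pos
  have hqR : (0 : ℝ) < q := by exact_mod_cast hq0
  have hQR : (0 : ℝ) < Q := by exact_mod_cast hQ0
  set B := #(badPairs bad N)
  set D := ∑ U ∈ N.powersetCard j with HasBadPair bad U, #(sols l x₀ U)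
  set E := #{U ∈ N.powersetCard j | HasBadPair bad U}
  have hD : (D : ℝ) / Q ≤ B / (q : ℝ) ^ 2 * (L ^ (2 + k) + 1) ^ k := by
    have h := card_sq_mul_sum_card_sols_le l x₀ N L hL hN hspan bad hpair j
    have h' : (q : ℝ) ^ 2 * D ≤ B * ((L ^ (2 + j) + 1) ^ j * Q) := by exact_mod_cast h
    have h2 : ((L : ℝ) ^ (2 + j) + 1) ^ j ≤ (L ^ (2 + k) + 1) ^ k := by
      have hL' : (1 : ℝ) ≤ L := by exact_mod_cast hL
      have : (1 : ℝ) ≤ L ^ (2 + j) + 1 := by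
        have : (0 : ℝ) ≤ L ^ (2 + j) := by positivity
        linarith
      calc ((L : ℝ) ^ (2 + j) + 1) ^ j ≤ (L ^ (2 + j) + 1) ^ k := pow_le_pow_right₀ this hj
        _ ≤ _ := by gcongr
    rw [div_le_iff₀ hQR, div_mul_eq_mul_div, div_mul_eq_mul_div, le_div_iff₀ (by positivity)]
    calc (D : ℝ) * q ^ 2 = q ^ 2 * D := mul_comm _ _
      _ ≤ _ := h'
      _ ≤ B * ((L ^ (2 + k) + 1) ^ k * Q) := by gcongr
      _ = _ := by ring
  have hE : (E : ℝ) / (q : ℝ) ^ j ≤ B / (q : ℝ) ^ 2 := by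
    have h : (q : ℝ) ^ 2 * E ≤ B * (q : ℝ) ^ j := by
      exact_mod_cast sq_mul_card_filter_hasBadPair_le N bad q j hN
    rw [div_le_div_iff₀ (by positivity) (by positivity)]
    linarith
  -- Sets without a bad pair contribute exactly `Q / q ^ j` each. The error is thus `E`, the bad
  -- sets missing from the main term, and `D`, their true contribution.
  have hmain : ((∑ v : V, (#(hits l x₀ N v)).choose j : ℕ) : ℝ) / Q =
      ((#N).choose j : ℝ) / (q : ℝ) ^ j - E / (q : ℝ) ^ j + D / Q := by
    rw [sum_choose_card_hits,
      ← Finset.sum_filter_add_sum_filter_not (N.powersetCard j) (HasBadPair bad)]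
    have hgood : ∑ U ∈ N.powersetCard j with ¬ HasBadPair bad U, ((#(sols l x₀ U) : ℕ) : ℝ) =
        (#{U ∈ N.powersetCard j | ¬ HasBadPair bad U} : ℝ) * (Q / (q : ℝ) ^ j) := by
      rw [← nsmul_eq_mul, ← Finset.sum_const]
      refine Finset.sum_congr rfl fun U hU => ?_
      rw [Finset.mem_filter, Finset.mem_powersetCard] at hU
      obtain ⟨⟨hUN, hUj⟩, hU⟩ := hU
      have := card_pow_mul_card_sols l x₀ N k bad hind U hUN (hUj ▸ hj) hU
      rw [hUj] at this
      rw [eq_div_iff (by positivity), mul_comm]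
      exact_mod_cast this
    have hcard : ((#N).choose j : ℝ) =
        E + (#{U ∈ N.powersetCard j | ¬ HasBadPair bad U} : ℝ) := by
      rw [← Finset.card_powersetCard,
        ← Finset.card_filter_add_card_filter_not (s := N.powersetCard j) (HasBadPair bad)]
      push_cast
      rfl
    rw [hcard, Nat.cast_add, Nat.cast_sum (Finset.filter (fun U => ¬ HasBadPair bad U) _), hgood]
    generalize (#{U ∈ N.powersetCard j | ¬ HasBadPair bad U} : ℝ) = G
    change ((D : ℝ) + G * (Q / (q : ℝ) ^ j)) / Q = (E + G) / (q : ℝ) ^ j - E / (q : ℝ) ^ j + D / Q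
    generalize (q : ℝ) ^ j = r
    rw [add_div, mul_div_assoc, div_right_comm, div_self hQR.ne', add_div]
    ring
  have hc := abs_choose_div_pow_sub_le (j := j) hq0 hN
  have hc' : (j * (j + (q - #N)) / q : ℝ) ≤ k * (k + (q - #N)) / q := by
    have h1 : (#N : ℝ) ≤ q := Nat.cast_le.mpr hN
    have h2 : (0 : ℝ) ≤ q - #N := sub_nonneg.mpr h1
    have h3 : (j : ℝ) ≤ k := Nat.cast_le.mpr hj
    gcongr
  have hD0 : 0 ≤ (D : ℝ) / Q := div_nonneg (Nat.cast_nonneg _) hQR.le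
  have hE0 : 0 ≤ (E : ℝ) / (q : ℝ) ^ j :=
    div_nonneg (Nat.cast_nonneg _) (pow_nonneg hqR.le _)
  have := abs_le.mp hc
  rw [hmain, abs_le]
  constructor <;> linarith

/-- If `l` is linearly independent on the sets of at most `k` elements without bad pairs and `B`
is the number of bad pairs, then the proportion of the `v` at which no `l n` equals `x₀` is close
to `1 / e`. -/
theorem abs_card_filter_hits_eq_empty_sub_le (l : α → Module.Dual F V) (x₀ : F) (N : Finset α)
    (L k : ℕ) (hk : 1 ≤ k) (hL : 1 ≤ L) (hN : #N ≤ Fintype.card F)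
    (hspan : ∀ U S : Finset α, S ⊆ N →
      (∀ n ∈ S, l n ∈ Submodule.span F (l '' (U : Set α))) → #S ≤ L ^ #U)
    (bad : α → α → Prop)
    (hind : ∀ [DecidableEq α], ∀ U ⊆ N, ∀ n ∈ N, n ∉ U → #U < k → ¬ HasBadPair bad (insert n U) →
      l n ∉ Submodule.span F (l '' (U : Set α)))
    (hpair : ∀ [DecidableEq α], ∀ a ∈ N, ∀ b ∈ N, a ≠ b →
      Fintype.card F ^ 2 * #(sols l x₀ {a, b}) ≤ Fintype.card V) :
    |(#{v : V | #(hits l x₀ N v) = 0} : ℝ) / Fintype.card V - 1 / Real.exp 1| ≤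
      3 / (k.factorial : ℝ) + (k + 1) *
      ((#(badPairs bad N) : ℝ) / (Fintype.card F : ℝ) ^ 2 * ((L ^ (2 + k) + 1) ^ k + 1) +
        k * (k + (Fintype.card F - #N)) / (Fintype.card F : ℝ)) := by
  classical
  set ε := (#(badPairs bad N) : ℝ) / (Fintype.card F : ℝ) ^ 2 * ((L ^ (2 + k) + 1) ^ k + 1) +
        k * (k + (Fintype.card F - #N)) / (Fintype.card F : ℝ)
  set Q := Fintype.card V with hQ
  have hQR : (0 : ℝ) < Q := by exact_mod_cast (Fintype.card_pos : 0 < Fintype.card V)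
  set S : ℕ → ℝ := fun j => ((∑ v : V, (#(hits l x₀ N v)).choose j : ℕ) : ℝ) with hS
  have hSj : ∀ j ≤ k, |S j / Q - 1 / (j.factorial : ℝ)| ≤ ε :=
    abs_sum_choose_card_hits_div_sub_le l x₀ N L k hL hN hspan bad hind hpair
  have h1 : |(#{v : V | #(hits l x₀ N v) = 0} : ℝ) / Q - ∑ j ∈ range k, (-1 : ℝ) ^ j * (S j / Q)| ≤
      S k / Q := by
    have h := abs_card_filter_eq_zero_sub_le (fun v : V => #(hits l x₀ N v)) k hk
    have e : (#{v : V | #(hits l x₀ N v) = 0} : ℝ) / Q -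
        ∑ j ∈ range k, (-1 : ℝ) ^ j * (S j / Q) = ((#{v : V | #(hits l x₀ N v) = 0} : ℝ) -
        ∑ j ∈ range k, (-1 : ℝ) ^ j * S j) / Q := by
      rw [sub_div, Finset.sum_div]
      simp only [mul_div_assoc]
    rw [e, abs_div, abs_of_pos hQR]
    gcongr
  have h2 : |∑ j ∈ range k, (-1 : ℝ) ^ j * (S j / Q) -
      ∑ j ∈ range k, (-1 : ℝ) ^ j / (j.factorial : ℝ)| ≤ k * ε := by
    rw [← Finset.sum_sub_distrib]
    refine (Finset.abs_sum_le_sum_abs _ _).trans ?_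
    calc _ ≤ ∑ j ∈ range k, ε := by
          refine Finset.sum_le_sum fun j hj => ?_
          have e : (-1 : ℝ) ^ j * (S j / Q) - (-1 : ℝ) ^ j / (j.factorial : ℝ) =
            (-1) ^ j * (S j / Q - 1 / (j.factorial : ℝ)) := by ring
          rw [e, abs_mul, abs_pow, abs_neg, abs_one, one_pow, one_mul]
          exact hSj j (Finset.mem_range.mp hj).le
      _ = _ := by simp
  have h3 : |Real.exp (-1) - ∑ j ∈ range k, (-1 : ℝ) ^ j / (j.factorial : ℝ)| ≤
      2 / (k.factorial : ℝ) := by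
    refine (Real.exp_bound (x := -1) (by simp) (n := k) hk).trans ?_
    have hk' : (1 : ℝ) ≤ k := by exact_mod_cast hk
    have hf : (0 : ℝ) < k.factorial := by exact_mod_cast k.factorial_pos
    rw [abs_neg, abs_one, one_pow, one_mul, div_le_div_iff₀ (by positivity) hf]
    push_cast
    nlinarith
  have h4 := abs_le.mp (hSj k le_rfl)
  have e : 1 / Real.exp 1 = Real.exp (-1) := by rw [Real.exp_neg, one_div]
  -- `2 / k!` is the tail of the exponential series and `1 / k!` the main part of the Bonferroni
  -- remainder `S k / Q`. That remainder and the `k` summed terms give `k + 1` copies of `ε`.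
  have e3 : 3 / (k.factorial : ℝ) = 2 / (k.factorial : ℝ) + 1 / (k.factorial : ℝ) := by ring
  rw [e, e3]
  have h1 := abs_le.mp h1
  have h2 := abs_le.mp h2
  have h3 := abs_le.mp h3
  rw [abs_le]
  constructor <;> linarith

end Poisson

/-! ### Dependence among the forms, read off from prime factorizations. -/

section Coordinates

/-- Row rank is at most the number of columns: the vectors `R i = (l u (e i))_u` lie in `F ^ U`, so
at most `#U` of them span all. Each `f` in the span has the form `f (e i) = φ (R i)` with `φ`
linear, so it vanishes at every `e i` once it does so on the spanning rows. -/
theorem exists_coordinates_of_span {F V α ι : Type*} [Field F] [AddCommGroup V] [Module F V]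
    (l : α → Module.Dual F V) (e : ι → V) (U : Finset α) :
    ∃ I : Finset ι, #I ≤ #U ∧ ∀ f ∈ Submodule.span F (l '' (U : Set α)),
      (∀ i ∈ I, f (e i) = 0) → ∀ i, f (e i) = 0 := by
  classical
  set R : ι → U → F := fun i u => l u (e i) with hR
  obtain ⟨κ, a, ha, hspan, hli⟩ := exists_linearIndependent' F R
  have : Finite κ := hli.finite
  have := Fintype.ofFinite κ
  refine ⟨univ.image a, ?_, ?_⟩
  · have h := hli.fintype_card_le_finrank
    rw [Module.finrank_fintype_fun_eq_card, Fintype.card_coe] at h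
    exact Finset.card_image_le.trans h
  · intro f hf h0
    obtain ⟨φ, hφ⟩ : ∃ φ : (U → F) →ₗ[F] F, ∀ i, f (e i) = φ (R i) := by
      clear h0
      induction hf using Submodule.span_induction with
      | mem x hx =>
        obtain ⟨u, hu, rfl⟩ := hx
        exact ⟨LinearMap.proj ⟨u, hu⟩, fun i => rfl⟩
      | zero => exact ⟨0, fun i => rfl⟩
      | add x y _ _ hx hy =>
        obtain ⟨φ, hφ⟩ := hx
        obtain ⟨ψ, hψ⟩ := hy
        exact ⟨φ + ψ, fun i => by simp [hφ, hψ]⟩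
      | smul c x _ hx =>
        obtain ⟨φ, hφ⟩ := hx
        exact ⟨c • φ, fun i => by simp [hφ]⟩
    intro i
    rw [hφ]
    have hle : Submodule.span F (Set.range R) ≤ LinearMap.ker φ := by
      rw [← hspan, Submodule.span_le]
      rintro _ ⟨x, rfl⟩
      have := h0 (a x) (by simp)
      rw [hφ] at this
      simpa using this
    simpa using hle (Submodule.subset_span ⟨i, rfl⟩)

theorem exists_prm_eq {p q : ℕ} (hp : p.Prime) (hpq : p < q) : ∃ i : Fin (dim q), prm i = p := by
  refine ⟨⟨Nat.count Nat.Prime p, ?_⟩, Nat.nth_count hp⟩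
  have : dim q = Nat.count Nat.Prime q := by
    rw [dim, Nat.primeCounting, Nat.primeCounting', Nat.sub_add_cancel (by omega)]
  rw [this]
  exact Nat.count_strict_mono hp hpq

theorem linForm_single (q n : ℕ) (i : Fin (dim q)) :
    linForm q n (Pi.single i 1) = (mu i n : ZMod q) := by
  simp [linForm_apply, Pi.single_apply]

theorem mu_lt {q n : ℕ} (i : ℕ) (hn : n ∈ Icc 2 (q - 1)) : mu i n < q := by
  rw [Finset.mem_Icc] at hn
  have := Nat.factorization_lt (prm i) (show n ≠ 0 by omega)
  rw [mu]
  omega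

/-- The exponents are below `q`, so reduction modulo `q` loses nothing and unique factorization
applies. -/
theorem eq_of_linForm_single_eq {q m n : ℕ} (hm : m ∈ Icc 2 (q - 1)) (hn : n ∈ Icc 2 (q - 1))
    (h : ∀ i, linForm q m (Pi.single i 1) = linForm q n (Pi.single i 1)) : m = n := by
  have hm' := Finset.mem_Icc.mp hm
  have hn' := Finset.mem_Icc.mp hn
  refine Nat.eq_of_factorization_eq' (by omega) (by omega) ?_
  ext p
  by_cases hp : p.Prime
  · rcases lt_or_ge p q with hpq | hpq
    · obtain ⟨i, hi⟩ := exists_prm_eq hp hpq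
      have := h i
      rw [linForm_single, linForm_single, ZMod.natCast_eq_natCast_iff',
        Nat.mod_eq_of_lt (mu_lt i hm), Nat.mod_eq_of_lt (mu_lt i hn), mu, mu, hi] at this
      exact this
    · rw [Nat.factorization_eq_zero_of_not_dvd, Nat.factorization_eq_zero_of_not_dvd]
      · intro h; have := Nat.le_of_dvd (by omega) h; omega
      · intro h; have := Nat.le_of_dvd (by omega) h; omega
  · simp [hp]

theorem mu_lt_log {q n : ℕ} (i : ℕ) (hn : n ∈ Icc 2 (q - 1)) : mu i n < Nat.log 2 q + 1 := by
  have hn' := Finset.mem_Icc.mp hn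
  refine Nat.lt_succ_of_le (Nat.le_log_of_pow_le (by norm_num) ?_)
  have hp : (prm i).Prime := Nat.prime_nth_prime i
  calc 2 ^ mu i n ≤ prm i ^ mu i n := Nat.pow_le_pow_left hp.two_le _
    _ ≤ n := Nat.le_of_dvd (by omega) (Nat.ordProj_dvd n _)
    _ ≤ q := by omega

variable {q : ℕ} [Fact q.Prime]

/-- Within the span, at most `#U` coordinates determine a form, hence its index `n`. Each coordinate
is an exponent, with at most `log₂ q + 1` possible values. -/
theorem card_le_of_linForm_mem_span (U S : Finset ℕ) (hS : S ⊆ Icc 2 (q - 1))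
    (h : ∀ n ∈ S, linForm q n ∈ Submodule.span (ZMod q) (linForm q '' (U : Set ℕ))) :
    #S ≤ (Nat.log 2 q + 1) ^ #U := by
  classical
  obtain ⟨I, hI, hcoord⟩ := exists_coordinates_of_span (linForm q)
    (fun i : Fin (dim q) => (Pi.single i 1 : Fin (dim q) → ZMod q)) U
  have hinj : Set.InjOn (fun n => fun i : I => mu (i : Fin (dim q)) n) (S : Set ℕ) := by
    intro m hm n hn hmn
    refine eq_of_linForm_single_eq (hS hm) (hS hn) fun i => ?_
    have := hcoord _ (Submodule.sub_mem _ (h m hm) (h n hn)) ?_ i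
    · rwa [LinearMap.sub_apply, sub_eq_zero] at this
    · intro i hi
      have : mu i m = mu i n := congrFun hmn ⟨i, hi⟩
      rw [LinearMap.sub_apply, linForm_single, linForm_single, this, sub_self]
  calc #S ≤ #(Fintype.piFinset fun _ : I => range (Nat.log 2 q + 1)) := by
        refine Finset.card_le_card_of_injOn _ (fun n hn => ?_) hinj
        simp only [SetLike.mem_coe, Fintype.mem_piFinset, Finset.mem_range]
        exact fun i => mu_lt_log _ (hS hn)
    _ = (Nat.log 2 q + 1) ^ #I := by simp
    _ ≤ _ := Nat.pow_le_pow_right (by omega) hI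

/-- The greatest common divisor exceeds `G`, or `a` is a square times a number at most `H`. -/
def LargeGcdOrNearSquare (G H a b : ℕ) : Prop :=
  G < a.gcd b ∨ ∃ s t, t ^ 2 * s = a ∧ s ≤ H

/-- Otherwise the coordinate at `p` vanishes on the whole span, whereas for `n` it is a nonzero
exponent below `q`. -/
theorem exists_dvd_of_linForm_mem_span {U : Finset ℕ} {n p : ℕ} (hn : n ∈ Icc 2 (q - 1))
    (h : linForm q n ∈ Submodule.span (ZMod q) (linForm q '' (U : Set ℕ)))
    (hp : p.Prime) (hpn : p ∣ n) : ∃ u ∈ U, p ∣ u := by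
  by_contra! hU
  have hn' := Finset.mem_Icc.mp hn
  have hpq : p < q := by have := Nat.le_of_dvd (by omega) hpn; omega
  obtain ⟨i, hi⟩ := exists_prm_eq hp hpq
  have hle : Submodule.span (ZMod q) (linForm q '' (U : Set ℕ)) ≤
      LinearMap.ker (LinearMap.applyₗ (R := ZMod q) (M₂ := ZMod q)
        (Pi.single i 1 : Fin (dim q) → ZMod q)) := by
    rw [Submodule.span_le]
    rintro _ ⟨u, hu, rfl⟩
    simp [linForm_single, mu, hi, Nat.factorization_eq_zero_of_not_dvd (hU u hu)]
  have h0 := hle h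
  simp only [LinearMap.mem_ker, LinearMap.applyₗ_apply_apply, linForm_single] at h0
  rw [ZMod.natCast_eq_zero_iff] at h0
  have h1 := Nat.eq_zero_of_dvd_of_lt h0 (mu_lt i hn)
  rw [mu, hi] at h1
  exact (hp.factorization_pos_of_dvd (by omega) hpn).ne' h1

theorem linForm_ne_zero {n : ℕ} (hn : n ∈ Icc 2 (q - 1)) : linForm q n ≠ 0 := by
  intro h
  have hn' := Finset.mem_Icc.mp hn
  obtain ⟨p, hp, hpn⟩ := Nat.exists_prime_and_dvd (show n ≠ 1 by omega)
  obtain ⟨u, hu, -⟩ := exists_dvd_of_linForm_mem_span (U := ∅) hn (by simp [h]) hp hpn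
  simp at hu

theorem linForm_notMem_span {G k : ℕ} (hG : 1 ≤ G) {U : Finset ℕ} {n : ℕ}
    (hn : n ∈ Icc 2 (q - 1)) (hnU : n ∉ U) (hk : #U < k)
    (hbad : ¬ HasBadPair (LargeGcdOrNearSquare G (G ^ k)) (insert n U)) :
    linForm q n ∉ Submodule.span (ZMod q) (linForm q '' (U : Set ℕ)) := by
  intro h
  have hn' := Finset.mem_Icc.mp hn
  have hpair : ∀ u ∈ U, ¬ LargeGcdOrNearSquare G (G ^ k) n u := fun u hu hb =>
    hbad ⟨n, mem_insert_self _ _, u, mem_insert_of_mem hu, by rintro rfl; exact hnU hu, hb⟩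
  obtain ⟨s, t, hst, hs⟩ := Nat.sq_mul_squarefree n
  obtain ⟨p, hp, hpn⟩ := Nat.exists_prime_and_dvd (show n ≠ 1 by omega)
  -- This shows that `U` is nonempty: the near-square condition concerns `n` alone, but it counts as
  -- bad only within a pair.
  obtain ⟨u, hu, -⟩ := exists_dvd_of_linForm_mem_span hn h hp hpn
  have hsG : G ^ k < s := by
    by_contra! hle
    exact hpair u hu (Or.inr ⟨s, t, hst, hle⟩)
  have hdvd : s ∣ ∏ u ∈ U, n.gcd u := by
    rw [← Nat.prod_primeFactors_of_squarefree hs]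
    refine Finset.prod_primes_dvd _ (fun p hp => (Nat.prime_of_mem_primeFactors hp).prime) ?_
    intro p hp
    have hpn : p ∣ n := (Nat.dvd_of_mem_primeFactors hp).trans ⟨t ^ 2, by rw [← hst, mul_comm]⟩
    obtain ⟨u, hu, hpu⟩ := exists_dvd_of_linForm_mem_span hn h (Nat.prime_of_mem_primeFactors hp) hpn
    exact (Nat.dvd_gcd hpn hpu).trans (Finset.dvd_prod_of_mem _ hu)
  have hpos : 0 < ∏ u ∈ U, n.gcd u :=
    Finset.prod_pos fun u _ => Nat.gcd_pos_of_pos_left _ (by omega)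
  have hle : ∏ u ∈ U, n.gcd u ≤ G ^ k :=
    calc ∏ u ∈ U, n.gcd u ≤ ∏ _u ∈ U, G :=
          Finset.prod_le_prod' fun u hu => not_lt.mp fun h => hpair u hu (Or.inl h)
      _ = G ^ #U := by simp
      _ ≤ G ^ k := Nat.pow_le_pow_right hG hk.le
  exact absurd (Nat.le_of_dvd hpos hdvd) (by omega)

/-- If the forms are proportional, a common value `x₀ ≠ 0` forces the factor to be 1 and hence `a =
b`; so dependent pairs have no common solution. -/
theorem card_sols_pair_le {x₀ : ZMod q} (hx : x₀ ≠ 0) {a b : ℕ} (ha : a ∈ Icc 2 (q - 1))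
    (hb : b ∈ Icc 2 (q - 1)) (hab : a ≠ b) :
    Fintype.card (ZMod q) ^ 2 * #(sols (linForm q) x₀ {a, b}) ≤
      Fintype.card (Fin (dim q) → ZMod q) := by
  by_cases h : linForm q a ∈ Submodule.span (ZMod q) (linForm q '' (({b} : Finset ℕ) : Set ℕ))
  · have : sols (linForm q) x₀ {a, b} = ∅ := by
      refine Finset.eq_empty_of_forall_notMem fun v hv => hab ?_
      rw [mem_sols] at hv
      have hva := hv a (by simp)
      have hvb := hv b (by simp)
      rw [Finset.coe_singleton, Set.image_singleton, Submodule.mem_span_singleton] at h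
      obtain ⟨c, hc⟩ := h
      rw [← hc, LinearMap.smul_apply, hvb, smul_eq_mul, mul_eq_right₀ hx] at hva
      rw [hva, one_smul] at hc
      exact eq_of_linForm_single_eq ha hb fun i => by rw [hc]
    simp [this]
  · have h1 := card_sols_insert (linForm q) x₀ {b} a h
    have h2 := card_sols_insert (linForm q) x₀ ∅ b (by simpa using linForm_ne_zero hb)
    rw [card_sols_empty, insert_empty_eq] at h2
    rw [← h2, ← h1, sq, mul_assoc]
    exact le_of_eq (by congr!)

end Coordinates

/-! ### Counting bad pairs. -/

section Counting

theorem card_filter_gcd_eq_le (q g : ℕ) (hg : 0 < g) :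
    #{p ∈ Icc 1 q ×ˢ Icc 1 q | p.1.gcd p.2 = g} ≤ (q / g) ^ 2 := by
  have : (q / g) ^ 2 = #(Icc 1 (q / g) ×ˢ Icc 1 (q / g)) := by simp [sq]
  rw [this]
  refine Finset.card_le_card_of_injOn (fun p => (p.1 / g, p.2 / g)) ?_ ?_
  · rintro ⟨a, b⟩ h
    simp only [coe_filter, Finset.mem_product, Finset.mem_Icc, Set.mem_ofPred_eq, coe_product,
      coe_Icc, Set.mem_prod, Set.mem_Icc] at h ⊢
    obtain ⟨⟨⟨ha, ha'⟩, hb, hb'⟩, rfl⟩ := h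
    exact ⟨⟨Nat.div_pos (Nat.gcd_le_left _ ha) hg, Nat.div_le_div_right ha'⟩,
      Nat.div_pos (Nat.gcd_le_right _ hb) hg, Nat.div_le_div_right hb'⟩
  · rintro ⟨a, b⟩ h ⟨a', b'⟩ h' heq
    simp only [coe_filter, Set.mem_ofPred_eq] at h h'
    simp only [Prod.mk.injEq] at heq ⊢
    have h1 : g ∣ a := h.2 ▸ Nat.gcd_dvd_left _ _
    have h2 : g ∣ b := h.2 ▸ Nat.gcd_dvd_right _ _
    have h3 : g ∣ a' := h'.2 ▸ Nat.gcd_dvd_left _ _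
    have h4 : g ∣ b' := h'.2 ▸ Nat.gcd_dvd_right _ _
    exact ⟨(Nat.div_left_inj h1 h3).mp heq.1, (Nat.div_left_inj h2 h4).mp heq.2⟩

/-- Pairs with gcd equal to `g` number at most `(q / g) ^ 2`, and the tail of `∑ 1 / g ^ 2` beyond
`G` is at most `1 / G`. -/
theorem card_filter_lt_gcd_le (q G : ℕ) (hG : 1 ≤ G) :
    (#{p ∈ Icc 1 q ×ˢ Icc 1 q | G < p.1.gcd p.2} : ℝ) ≤ (q : ℝ) ^ 2 / G := by
  have h1 : #{p ∈ Icc 1 q ×ˢ Icc 1 q | G < p.1.gcd p.2} ≤ ∑ g ∈ Ioc G q, (q / g) ^ 2 := by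
    calc _ ≤ #((Ioc G q).biUnion fun g => {p ∈ Icc 1 q ×ˢ Icc 1 q | p.1.gcd p.2 = g}) := by
          refine Finset.card_le_card fun p hp => ?_
          simp only [Finset.mem_filter, Finset.mem_product, Finset.mem_Icc, Finset.mem_biUnion,
            Finset.mem_Ioc] at hp ⊢
          exact ⟨_, ⟨hp.2, (Nat.gcd_le_left _ (by omega)).trans hp.1.1.2⟩, hp.1, rfl⟩
      _ ≤ _ := Finset.card_biUnion_le.trans <| Finset.sum_le_sum fun g hg =>
          card_filter_gcd_eq_le q g (by rw [Finset.mem_Ioc] at hg; omega)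
  calc _ ≤ ((∑ g ∈ Ioc G q, (q / g) ^ 2 : ℕ) : ℝ) := by exact_mod_cast h1
    _ ≤ ∑ g ∈ Ioc G q, (q : ℝ) ^ 2 * ((g : ℝ) ^ 2)⁻¹ := by
        push_cast
        refine Finset.sum_le_sum fun g _ => ?_
        rw [← div_eq_mul_inv, ← div_pow]
        gcongr
        exact Nat.cast_div_le
    _ = (q : ℝ) ^ 2 * ∑ g ∈ Ioc G q, ((g : ℝ) ^ 2)⁻¹ := by rw [Finset.mul_sum]
    _ ≤ (q : ℝ) ^ 2 * (G : ℝ)⁻¹ := by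
        gcongr
        rcases le_or_gt G q with h | h
        · refine (sum_Ioc_inv_sq_le_sub (by omega) h).trans ?_
          have : (0 : ℝ) ≤ (q : ℝ)⁻¹ := by positivity
          linarith
        · rw [Finset.Ioc_eq_empty_of_le h.le]
          simp
    _ = _ := by rw [div_eq_mul_inv]

open Classical in
theorem card_filter_nearSquare_le (q H : ℕ) :
    #{a ∈ Icc 1 q | ∃ s t, t ^ 2 * s = a ∧ s ≤ H} ≤ Nat.sqrt q * H := by
  calc _ ≤ #((Icc 1 (Nat.sqrt q) ×ˢ Icc 1 H).image fun p => p.1 ^ 2 * p.2) := by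
        refine Finset.card_le_card fun a ha => ?_
        simp only [Finset.mem_filter, Finset.mem_Icc, Finset.mem_image, Finset.mem_product,
          Prod.exists] at ha ⊢
        obtain ⟨⟨h1, h2⟩, s, t, rfl, hs⟩ := ha
        have ht : 0 < t := Nat.pos_of_ne_zero (by rintro rfl; simp at h1)
        have hs' : 0 < s := Nat.pos_of_ne_zero (by rintro rfl; simp at h1)
        refine ⟨t, s, ⟨⟨ht, Nat.le_sqrt'.mpr ?_⟩, hs', hs⟩, rfl⟩
        exact (Nat.le_mul_of_pos_right _ hs').trans h2
    _ ≤ _ := Finset.card_image_le.trans (by simp)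

theorem card_badPairs_le (q G H : ℕ) (hG : 1 ≤ G) :
    (#(badPairs (LargeGcdOrNearSquare G H) (Icc 2 (q - 1))) : ℝ) ≤
      (q : ℝ) ^ 2 / G + q * (Real.sqrt q * H) := by
  classical
  have h1 : badPairs (LargeGcdOrNearSquare G H) (Icc 2 (q - 1)) ⊆
      {p ∈ Icc 1 q ×ˢ Icc 1 q | G < p.1.gcd p.2} ∪
        {a ∈ Icc 1 q | ∃ s t, t ^ 2 * s = a ∧ s ≤ H} ×ˢ Icc 1 q := by
    rintro ⟨a, b⟩ h
    rw [badPairs, Finset.mem_filter, Finset.mem_offDiag] at h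
    obtain ⟨⟨ha, hb, -⟩, h⟩ := h
    simp only [Finset.mem_filter, Finset.mem_Icc, Finset.mem_union, Finset.mem_product] at ha hb ⊢
    rcases h with h | h
    · exact Or.inl ⟨⟨⟨by omega, by omega⟩, by omega, by omega⟩, h⟩
    · exact Or.inr ⟨⟨⟨by omega, by omega⟩, h⟩, by omega, by omega⟩
  have h2 := (Finset.card_le_card h1).trans (Finset.card_union_le _ _)
  rw [Finset.card_product, Nat.card_Icc, Nat.add_sub_cancel] at h2
  calc _ ≤ (#{p ∈ Icc 1 q ×ˢ Icc 1 q | G < p.1.gcd p.2} : ℝ) +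
        (#{a ∈ Icc 1 q | ∃ s t, t ^ 2 * s = a ∧ s ≤ H} : ℝ) * q := by exact_mod_cast h2
    _ ≤ (q : ℝ) ^ 2 / G + (Real.sqrt q * H) * q := by
        gcongr
        · exact card_filter_lt_gcd_le q G hG
        · calc _ ≤ ((Nat.sqrt q * H : ℕ) : ℝ) := by
                exact_mod_cast card_filter_nearSquare_le q H
            _ ≤ _ := by
                push_cast
                gcongr
                exact Real.nat_sqrt_le_real_sqrt
    _ = _ := by ring

end Counting

theorem density_eq {q : ℕ} [Fact q.Prime] {x₀ : ZMod q} (hx : x₀ ≠ 0) :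
    density q x₀ = (#{v | #(hits (linForm q) x₀ (Icc 2 (q - 1)) v) = 0} : ℝ) /
      Fintype.card (Fin (dim q) → ZMod q) := by
  have hq := (Fact.out : q.Prime).two_le
  rw [density, numAvoiding]
  congr 1
  · rw [← Set.ncard_coe_finset]
    congr 2
    ext v
    simp only [Set.mem_ofPred_eq, coe_filter, mem_univ, true_and, Finset.card_eq_zero,
      Finset.eq_empty_iff_forall_notMem, mem_hits, Finset.mem_Icc]
    refine ⟨fun h n hn => h n ⟨by omega, hn.1.2⟩ hn.2, fun h n hn hnv => ?_⟩
    -- The form of `n = 1` is zero and never takes the value `x₀ ≠ 0`, so this index can be dropped.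
    rcases eq_or_ne n 1 with rfl | hn1
    · apply hx
      rw [← hnv]
      simp [linForm_apply, mu]
    · exact h n ⟨⟨by omega, hn.2⟩, hnv⟩
  · simp [ZMod.card]

/-- The estimate with `k` and `G` still free. `1 / G + G ^ k / √q` bounds the density of bad pairs,
and the 2 in `k + 2` is `q - #(Icc 2 (q - 1))`. -/
theorem abs_density_sub_le {q : ℕ} [Fact q.Prime] {x₀ : ZMod q} (hx : x₀ ≠ 0) (k G : ℕ)
    (hk : 1 ≤ k) (hG : 1 ≤ G) :
    |density q x₀ - 1 / Real.exp 1| ≤ 3 / (k.factorial : ℝ) + (k + 1) *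
      ((1 / G + G ^ k / Real.sqrt q) * ((((Nat.log 2 q : ℝ) + 1) ^ (2 + k) + 1) ^ k + 1) +
        k * (k + 2) / q) := by
  have hq := (Fact.out : q.Prime).two_le
  have hqR : (0 : ℝ) < q := by positivity
  have hN : #(Icc 2 (q - 1)) = q - 2 := by simp; omega
  rw [density_eq hx]
  refine (abs_card_filter_hits_eq_empty_sub_le (linForm q) x₀ (Icc 2 (q - 1)) (Nat.log 2 q + 1) k
    hk (by omega) (by rw [ZMod.card]; omega) card_le_of_linForm_mem_span
    (LargeGcdOrNearSquare G (G ^ k)) ?_ ?_).trans ?_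
  · intro inst U _ n hn hnU hU hbad
    exact linForm_notMem_span hG hn hnU hU (by convert hbad)
  · intro inst a ha b hb hab
    convert card_sols_pair_le hx ha hb hab
  · have hB : (#(badPairs (LargeGcdOrNearSquare G (G ^ k)) (Icc 2 (q - 1))) : ℝ) / (q : ℝ) ^ 2 ≤
        1 / G + G ^ k / Real.sqrt q := by
      have hs : (0 : ℝ) < Real.sqrt q := Real.sqrt_pos.mpr hqR
      have hss : Real.sqrt q * Real.sqrt q = q := Real.mul_self_sqrt hqR.le
      rw [div_le_iff₀ (by positivity)]
      refine (card_badPairs_le q G (G ^ k) hG).trans (le_of_eq ?_)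
      push_cast
      generalize Real.sqrt q = r at hs hss ⊢
      rw [← hss]
      field_simp
    rw [ZMod.card, hN, Nat.cast_sub hq]
    push_cast
    gcongr
    linarith

end FixedPoints

namespace FixedPoints

/-! ### Choice of parameters and the final estimate. -/

open Filter Topology

theorem eventually_two_mul_pow_le_exp : ∀ᶠ y : ℝ in atTop, 2 * (y + 3) ^ 5 ≤ Real.exp y := by
  have h := (Real.tendsto_pow_mul_exp_neg_atTop_nhds_zero 5).comp
    (tendsto_atTop_add_const_right atTop (3 : ℝ) tendsto_id)
  have hpos : (0 : ℝ) < Real.exp (-3) / 2 := by positivity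
  filter_upwards [h.eventually_lt_const hpos] with y hy
  simp only [Function.comp_apply, id_eq] at hy
  rw [show -(y + 3) = -y + -3 by ring, Real.exp_add, ← mul_assoc, Real.exp_neg] at hy
  have h3 : 0 < Real.exp (-3) := Real.exp_pos _
  have hy0 : 0 < Real.exp y := Real.exp_pos _
  have : (y + 3) ^ 5 * (Real.exp y)⁻¹ < 1 / 2 := by nlinarith
  rw [← div_eq_mul_inv, div_lt_iff₀ hy0] at this
  linarith

theorem natLog_two_add_one_le {q : ℕ} {y : ℝ} (hy : 0 ≤ y) (hq : Real.log q = Real.exp y) :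
    (Nat.log 2 q : ℝ) + 1 ≤ Real.exp (y + 1) := by
  have h1 : (Nat.log 2 q : ℝ) ≤ Real.logb 2 q := by
    have := Real.natLog_le_logb q 2
    exact_mod_cast this
  have h2 : Real.logb 2 q ≤ 1.5 * Real.exp y := by
    rw [Real.logb, hq, div_le_iff₀ (Real.log_pos (by norm_num))]
    have := Real.log_two_gt_d9
    have := Real.exp_pos y
    nlinarith
  have h3 : 1 ≤ Real.exp y := Real.one_le_exp hy
  rw [Real.exp_add]
  have := Real.exp_one_gt_d9
  nlinarith

/-- Here `y = log log q`. The moment factor is at most `exp ((y + 3) ^ 3)`, so `G` near `exp ((y +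
3) ^ 4)` outweighs it. Then `G ^ k` is roughly at most `exp ((y + 3) ^ 5)`, which must stay below
`√q = exp (exp y / 2)`; this is the source of `hexp`. The constant is `6 = 3 + 2 + 1`: the factorial
term, the bad pairs, and the binomial coefficient error. -/
theorem error_le {q : ℕ} {y : ℝ} (hy : 1 ≤ y) (hexp : 2 * (y + 3) ^ 5 ≤ Real.exp y)
    (hq : (q : ℝ) = Real.exp (Real.exp y)) {k G : ℕ} (hk : y ≤ k) (hk' : (k : ℝ) ≤ y + 1)
    (hG : Real.exp ((y + 3) ^ 4) ≤ G) (hG' : (G : ℝ) ≤ Real.exp ((y + 3) ^ 4) + 1) :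
    3 / (k.factorial : ℝ) + (k + 1) *
      ((1 / G + G ^ k / Real.sqrt q) * ((((Nat.log 2 q : ℝ) + 1) ^ (2 + k) + 1) ^ k + 1) +
        k * (k + 2) / q) ≤ 6 / y := by
  have hy0 : 0 < y := by linarith
  have two_le : (2 : ℝ) ≤ Real.exp 1 := by linarith [Real.exp_one_gt_d9]
  have hfac : 3 / (k.factorial : ℝ) ≤ 3 / y := by
    have : (k : ℝ) ≤ k.factorial := by exact_mod_cast Nat.self_le_factorial k
    gcongr
    linarith
  set L : ℝ := (Nat.log 2 q : ℝ) + 1 with hLdef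
  have hL : L ≤ Real.exp (y + 1) := natLog_two_add_one_le hy0.le (by rw [hq, Real.log_exp])
  have hL1 : 1 ≤ L := by
    have : (0 : ℝ) ≤ Nat.log 2 q := Nat.cast_nonneg _
    linarith
  have hM1 : L ^ (2 + k) + 1 ≤ Real.exp ((y + 3) ^ 2) := by
    have h1 : 1 ≤ L ^ (2 + k) := one_le_pow₀ hL1
    calc L ^ (2 + k) + 1 ≤ 2 * L ^ (2 + k) := by linarith
      _ ≤ Real.exp 1 * Real.exp (y + 1) ^ (2 + k) := by gcongr
      _ = Real.exp (1 + (2 + k) * (y + 1)) := by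
          rw [← Real.exp_nat_mul, ← Real.exp_add]
          push_cast
          rfl
      _ ≤ _ := by
          apply Real.exp_le_exp.mpr
          nlinarith
  have hM : (L ^ (2 + k) + 1) ^ k + 1 ≤ Real.exp ((y + 3) ^ 3) := by
    have h0 : 1 ≤ L ^ (2 + k) := one_le_pow₀ hL1
    have h1 : 1 ≤ (L ^ (2 + k) + 1) ^ k := one_le_pow₀ (by linarith)
    calc (L ^ (2 + k) + 1) ^ k + 1 ≤ 2 * (L ^ (2 + k) + 1) ^ k := by linarith
      _ ≤ Real.exp 1 * Real.exp ((y + 3) ^ 2) ^ k := by gcongr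
      _ = Real.exp (1 + k * (y + 3) ^ 2) := by rw [← Real.exp_nat_mul, ← Real.exp_add]
      _ ≤ _ := by
          apply Real.exp_le_exp.mpr
          nlinarith [mul_le_mul_of_nonneg_right hk' (sq_nonneg (y + 3))]
  have hGk : (G : ℝ) ^ k / Real.sqrt q ≤ Real.exp (-(y + 3) ^ 4) := by
    have hs : Real.sqrt q = Real.exp (Real.exp y / 2) := by rw [hq, ← Real.exp_half]
    have h1 : (G : ℝ) ≤ Real.exp ((y + 3) ^ 4 + 1) := by
      have : 1 ≤ Real.exp ((y + 3) ^ 4) := Real.one_le_exp (by positivity)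
      rw [Real.exp_add]
      nlinarith
    rw [hs, div_le_iff₀ (Real.exp_pos _), ← Real.exp_add]
    calc (G : ℝ) ^ k ≤ Real.exp ((y + 3) ^ 4 + 1) ^ k := by gcongr
      _ = Real.exp (k * ((y + 3) ^ 4 + 1)) := by rw [← Real.exp_nat_mul]
      _ ≤ _ := by
          apply Real.exp_le_exp.mpr
          -- The exponents to compare add up to `(y + 2) * (y + 3) ^ 4 + (y + 1)`; absorbing `y + 1`
          -- gives at most `(y + 3) ^ 5 ≤ exp y / 2`.
          have h4 : y + 1 ≤ (y + 3) ^ 4 := by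
            have : y + 3 ≤ (y + 3) ^ 4 := le_self_pow₀ (by linarith) (by norm_num)
            linarith
          have h5 : (k : ℝ) * ((y + 3) ^ 4 + 1) ≤ (y + 1) * ((y + 3) ^ 4 + 1) := by gcongr
          have h6 : (y + 3) ^ 5 = (y + 3) * (y + 3) ^ 4 := by ring
          nlinarith
  have hG1 : 1 / (G : ℝ) ≤ Real.exp (-(y + 3) ^ 4) := by
    rw [Real.exp_neg, ← one_div]
    exact one_div_le_one_div_of_le (Real.exp_pos _) hG
  have hprod : (1 / (G : ℝ) + G ^ k / Real.sqrt q) * ((L ^ (2 + k) + 1) ^ k + 1) ≤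
      2 * Real.exp (-(y + 3) ^ 3) := by
    have h0 : 0 ≤ (L ^ (2 + k) + 1) ^ k + 1 := by positivity
    calc _ ≤ (2 * Real.exp (-(y + 3) ^ 4)) * Real.exp ((y + 3) ^ 3) := by
          gcongr
          linarith
      _ = 2 * Real.exp (-(y + 3) ^ 4 + (y + 3) ^ 3) := by rw [mul_assoc, ← Real.exp_add]
      _ ≤ _ := by
          gcongr
          have : 0 ≤ (y + 3) ^ 3 := by positivity
          have e : (y + 3) ^ 4 = (y + 3) * (y + 3) ^ 3 := by ring
          nlinarith
  have hA : (k + 1) * (2 * Real.exp (-(y + 3) ^ 3)) ≤ 2 / y := by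
    rw [le_div_iff₀ hy0, Real.exp_neg]
    have h1 : (y + 3) ^ 3 ≤ Real.exp ((y + 3) ^ 3) := by
      linarith [Real.add_one_le_exp ((y + 3) ^ 3)]
    have h2 : (k + 1) * y ≤ (y + 3) ^ 3 := by nlinarith [pow_pos hy0 3]
    have h3 : (k + 1) * y * (Real.exp ((y + 3) ^ 3))⁻¹ ≤ 1 := by
      rw [← div_eq_mul_inv, div_le_one (Real.exp_pos _)]
      exact h2.trans h1
    linarith
  have hB : (k + 1) * (k * (k + 2) / (q : ℝ)) ≤ 1 / y := by
    have hqpos : (0 : ℝ) < q := by rw [hq]; exact Real.exp_pos _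
    have hqy : Real.exp y ≤ q := by
      rw [hq]
      linarith [Real.add_one_le_exp (Real.exp y)]
    rw [← mul_div_assoc, div_le_div_iff₀ hqpos hy0]
    calc ((k : ℝ) + 1) * (k * (k + 2)) * y ≤ (y + 3) * ((y + 3) * (y + 3)) * (y + 3) := by
          have a1 : (k : ℝ) + 1 ≤ y + 3 := by linarith
          have a2 : (k : ℝ) + 2 ≤ y + 3 := by linarith
          have a3 : (k : ℝ) ≤ y + 3 := by linarith
          have a4 : y ≤ y + 3 := by linarith
          exact mul_le_mul (mul_le_mul a1 (mul_le_mul a3 a2 (by positivity) (by positivity))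
            (by positivity) (by positivity)) a4 hy0.le (by positivity)
      _ = (y + 3) ^ 4 := by ring
      _ ≤ (y + 3) ^ 5 := pow_le_pow_right₀ (by linarith) (by norm_num)
      _ ≤ 1 * q := by
          have : 0 ≤ (y + 3) ^ 5 := by positivity
          linarith
  have e : 6 / y = 3 / y + (2 / y + 1 / y) := by ring
  rw [e, mul_add]
  refine add_le_add hfac (add_le_add (le_trans ?_ hA) hB)
  gcongr

end FixedPoints

open FixedPoints Filter in
theorem theorem1p1 :
    ∃ C : ℝ, ∃ q₀ : ℕ, ∀ q : ℕ, q.Prime → q₀ ≤ q → ∀ x₀ : ZMod q, x₀ ≠ 0 →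
      |FixedPoints.density q x₀ - 1 / Real.exp 1| ≤ C / Real.log (Real.log q) := by
  have hy : Tendsto (fun q : ℕ => Real.log (Real.log q)) atTop atTop :=
    Real.tendsto_log_atTop.comp (Real.tendsto_log_atTop.comp tendsto_natCast_atTop_atTop)
  obtain ⟨q₀, hq₀⟩ := eventually_atTop.mp
    (hy.eventually ((eventually_ge_atTop 1).and eventually_two_mul_pow_le_exp))
  refine ⟨6, q₀, fun q hq hqq x₀ hx => ?_⟩
  have : Fact q.Prime := ⟨hq⟩
  obtain ⟨h1, h2⟩ := hq₀ q hqq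
  have hq1 : (1 : ℝ) < q := by exact_mod_cast hq.one_lt
  have hqe : (q : ℝ) = Real.exp (Real.exp (Real.log (Real.log q))) := by
    rw [Real.exp_log (Real.log_pos hq1), Real.exp_log (by linarith)]
  generalize Real.log (Real.log q) = y at h1 h2 hqe ⊢
  refine (abs_density_sub_le hx ⌈y⌉₊ ⌈Real.exp ((y + 3) ^ 4)⌉₊ (Nat.one_le_ceil_iff.mpr (by linarith))
    (Nat.one_le_ceil_iff.mpr (Real.exp_pos _))).trans ?_
  exact error_le h1 h2 hqe (Nat.le_ceil _) (Nat.ceil_lt_add_one (by linarith)).le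
    (Nat.le_ceil _) (Nat.ceil_lt_add_one (Real.exp_pos _).le).le
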